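/- Let $\mathbb K$ be a field of characteristic $0$. For a finite-dimensional nilpotent Lie algebra $\mathfrak g$ over $\mathbb K$, the breadth is $b(\mathfrak g)=\max\{\operatorname{rank}(\operatorname{ad}X) : X\in\mathfrak g\}$, and the characteristic sequence is $c(\mathfrak g)=\max\{c(X) : X\in\mathfrak g\setminus[\mathfrak g,\mathfrak g]\}$ for the lexicographic order, where $c(X)$ is the nonincreasing sequence of the dimensions of the Jordan blocks of the nilpotent operator $\operatorname{ad}X$. Let $X_1,\dots,X_n$ be the canonical basis of $\mathbb K^n$, let $\mu_0$ be the Lie bracket on $\mathbb K^n$ given by $\mu_0(X_1,X_2)=X_3$, $\mu_0(X_1,X_4)=X_5$ (the other brackets of basis vectors being zero or obtained by skew-symmetry), and let $\mathfrak g_{2,n-2}=(\mathbb K^n,\mu_0)$. Let $\mathcal F^{n,2}_{2,n-2}$ be the set of the Lie brackets $\mu$ on $\mathbb K^n$ for which $(\mathbb K^n,\mu)$ is $2$-step nilpotent with characteristic sequence $(2,2,1,\dots,1)$. Consider the skew-symmetric bilinear maps $\varphi:\mathbb K^n\times\mathbb K^n\to\mathbb K^n$ such that, for all $X,Y,Z$,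 $$\varphi(\mu_0(X,Y),Z)+\mu_0(\varphi(X,Y),Z)=0,\qquad \varphi(\varphi(X,Y),Z)=0 .$$ Let $\mathcal C_1$ be the set of the $\mu\in\mathcal F^{n,2}_{2,n-2}$ of the form $\mu=\mu_0+\varphi$ with $\varphi$ as above and, for some scalars $a_{i,j}^{3},a_{i,j}^{5}\in\mathbb K$, $$\varphi(X_i,X_j)=a_{i,j}^{3}X_3+a_{i,j}^{5}X_5,\qquad 2\le i<j\le n,\quad i,j\notin\{3,5\},$$ and let $\mathcal C_2$ be the set of the $\mu\in\mathcal F^{n,2}_{2,n-2}$ of the form $\mu=\mu_0+\varphi$ with $\varphi$ as above and, for some scalars $a_{i,j}^{3},a_{i,j}^{5}\in\mathbb K$, $$\begin{cases}\varphi(X_i,X_j)=a_{i,j}^{3}X_3+a_{i,j}^{5}X_5, & 2\le i<j\le n-1,\quad i,j\notin\{3,5\},\quad (i,j)\ne(2,4),\\ \varphi(X_2,X_4)=X_n,\end{cases}$$ where in both cases the products $\varphi(X_i,X_j)$, $i<j$, that are not listed are zero. Then every $n$-dimensional nilpotent Lie algebra over $\mathbb K$ with breadth $2$ and characteristic sequence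 $(2,2,1,\dots,1)$ is isomorphic to $(\mathbb K^n,\mu)$ for some $\mu\in\mathcal C_1\cup\mathcal C_2$. -/

import Mathlib

open Module

noncomputable section

section Invariants

/-- `c` is the list of the dimensions of the Jordan blocks, in nonincreasing order, of the
nilpotent operator `f`: there is a basis made of chains
`b⟨i,0⟩ ↦ b⟨i,1⟩ ↦ ⋯ ↦ b⟨i,cᵢ-1⟩ ↦ 0`, one for each entry `cᵢ` of `c`. -/
def IsNilpotentJordanType {K V : Type*} [Field K] [AddCommGroup V] [Module K V]
    (f : V →ₗ[K] V) (c : List ℕ) : Prop :=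
  c.Pairwise (fun p q => q ≤ p) ∧ (∀ m ∈ c, 0 < m) ∧
    ∃ b : Basis (Σ i : Fin c.length, Fin (c.get i)) K V,
      ∀ (i : Fin c.length) (j : Fin (c.get i)),
        f (b ⟨i, j⟩) = if h : (j : ℕ) + 1 < c.get i then b ⟨i, ⟨(j : ℕ) + 1, h⟩⟩ else 0

/-- `c` is the characteristic sequence of the nilpotent Lie algebra `L`: the maximum, for the
lexicographic order, of the Jordan types of `ad X`, for `X` outside the derived subalgebra. -/
def IsCharacteristicSequence (K L : Type*) [Field K] [LieRing L] [LieAlgebra K L]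
    (c : List ℕ) : Prop :=
  IsGreatest
    {d : List ℕ | ∃ X : L, X ∉ (⁅(⊤ : LieIdeal K L), (⊤ : LieIdeal K L)⁆ : LieIdeal K L) ∧
      IsNilpotentJordanType (LieAlgebra.ad K L X) d} c

/-- The breadth of a finite dimensional Lie algebra: the maximal rank of the operators `ad X`. -/
def lieBreadth (K L : Type*) [Field K] [LieRing L] [LieAlgebra K L] : ℕ :=
  sSup (Set.range fun X : L => finrank K (LinearMap.range (LieAlgebra.ad K L X)))

/-- The sequence `(2,2,1,…,1)` with `n - 4` entries `1`. -/
def seqTwoTwoOnes (n : ℕ) : List ℕ := 2 :: 2 :: List.replicate (n - 4) 1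

end Invariants

/-- A Lie bracket on the vector space `Kⁿ`. -/
structure LieBracketOn (K : Type*) [Field K] (n : ℕ) where
  /-- the underlying bilinear map -/
  toBilin : (Fin n → K) →ₗ[K] (Fin n → K) →ₗ[K] (Fin n → K)
  self : ∀ x, toBilin x x = 0
  jacobi : ∀ x y z, toBilin (toBilin x y) z + toBilin (toBilin y z) x
    + toBilin (toBilin z x) y = 0

namespace LieBracketOn

variable {K : Type*} [Field K] {n : ℕ}

/-- The Lie algebra `(Kⁿ, μ)`. -/
def Alg (_μ : LieBracketOn K n) : Type _ := Fin n → K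

instance (μ : LieBracketOn K n) : AddCommGroup μ.Alg := inferInstanceAs (AddCommGroup (Fin n → K))

instance (μ : LieBracketOn K n) : Module K μ.Alg := inferInstanceAs (Module K (Fin n → K))

theorem skew (μ : LieBracketOn K n) (x y : Fin n → K) :
    μ.toBilin x y = -μ.toBilin y x := by
  have h := μ.self (x + y)
  simp only [map_add, LinearMap.add_apply, μ.self, zero_add, add_zero] at h
  exact eq_neg_of_add_eq_zero_right h

instance (μ : LieBracketOn K n) : LieRing μ.Alg where
  bracket x y := μ.toBilin x y
  add_lie x y z := LinearMap.congr_fun (μ.toBilin.map_add x y) z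
  lie_add x y z := (μ.toBilin x).map_add y z
  lie_self x := μ.self x
  leibniz_lie x y z := by
    change μ.toBilin x (μ.toBilin y z)
      = μ.toBilin (μ.toBilin x y) z + μ.toBilin y (μ.toBilin x z)
    have h := μ.jacobi x y z
    rw [μ.skew (μ.toBilin y z) x, μ.skew (μ.toBilin z x) y, μ.skew z x, map_neg, neg_neg] at h
    linear_combination -h

instance (μ : LieBracketOn K n) : LieAlgebra K μ.Alg where
  lie_smul t x y := (μ.toBilin x).map_smul t y

end LieBracketOn

section Families

variable (K : Type*) [Field K] (n : ℕ)

/-- The canonical basis `X₁, …, Xₙ` of `Kⁿ`, with the numbering starting at `1`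
(and `X i = 0` for the other indices). -/
def stdX (i : ℕ) : Fin n → K := fun k => if (k : ℕ) + 1 = i then 1 else 0

/-- The coordinate form dual to `Xᵢ`, for `1 ≤ i ≤ n` (and `0` for the other indices). -/
def coordX (i : ℕ) : (Fin n → K) →ₗ[K] K :=
  ∑ k : Fin n, if (k : ℕ) + 1 = i then LinearMap.proj k else 0

variable {K n} in
/-- The skew-symmetric bilinear map `(x, y) ↦ (α x * β y - β x * α y) • v`. -/
def skewElem (α β : (Fin n → K) →ₗ[K] K) (v : Fin n → K) :
    (Fin n → K) →ₗ[K] (Fin n → K) →ₗ[K] (Fin n → K) :=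
  LinearMap.mk₂ K (fun x y => (α x * β y - β x * α y) • v)
    (fun x x' y => by simp only [map_add, ← add_smul]; congr 1; ring)
    (fun t x y => by simp only [map_smul, smul_eq_mul, smul_smul]; congr 1; ring)
    (fun x y y' => by simp only [map_add, ← add_smul]; congr 1; ring)
    (fun t x y => by simp only [map_smul, smul_eq_mul, smul_smul]; congr 1; ring)

/-- The bracket `μ₀` of the Lie algebra `𝔤_{2,n-2}`: `[X₁, X_{2i}] = X_{2i+1}` for `i = 1, 2`. -/
def mu0 : (Fin n → K) →ₗ[K] (Fin n → K) →ₗ[K] (Fin n → K) :=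
  ∑ i ∈ Finset.Icc 1 2, skewElem (coordX K n 1) (coordX K n (2 * i)) (stdX K n (2 * i + 1))

/-- The set of the brackets of the `n`-dimensional `2`-step nilpotent Lie algebras with
characteristic sequence `(2,2,1,…,1)`. -/
def familyF : Set (LieBracketOn K n) :=
  {μ | LieModule.nilpotencyLength μ.Alg μ.Alg = 2 ∧
    IsCharacteristicSequence K μ.Alg (seqTwoTwoOnes n)}

variable {K n}

/-- `φ` is skew-symmetric, belongs to `Z²_CH(𝔤_{2,n-2}, 𝔤_{2,n-2})`, that is
`φ ∘₁ μ₀ + μ₀ ∘₁ φ = 0`, and satisfies `φ ∘₁ φ = 0`. -/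
structure IsDeformationCocycle (φ : (Fin n → K) →ₗ[K] (Fin n → K) →ₗ[K] (Fin n → K)) :
    Prop where
  self : ∀ x, φ x x = 0
  cocycle : ∀ x y z, φ (mu0 K n x y) z + mu0 K n (φ x y) z = 0
  comp : ∀ x y z, φ (φ x y) z = 0

/-- The pairs `(i, j)` with `2 ≤ i < j ≤ m` and `i, j ∉ {3, 5}`. -/
def FreeIndex (m i j : ℕ) : Prop :=
  2 ≤ i ∧ i < j ∧ j ≤ m ∧ i ≠ 3 ∧ i ≠ 5 ∧ j ≠ 3 ∧ j ≠ 5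

/-- The cocycles of the first component; the products that are not listed are zero. -/
def IsCocycleOne (φ : (Fin n → K) →ₗ[K] (Fin n → K) →ₗ[K] (Fin n → K)) : Prop :=
  IsDeformationCocycle φ ∧
  (∃ a : ℕ → ℕ → ℕ → K, ∀ i j, FreeIndex n i j →
    φ (stdX K n i) (stdX K n j) =
      ∑ k ∈ Finset.Icc 1 2, a i j (2 * k + 1) • stdX K n (2 * k + 1)) ∧
  (∀ i j, 1 ≤ i → i < j → j ≤ n → ¬ FreeIndex n i j → φ (stdX K n i) (stdX K n j) = 0)

/-- The cocycles of the second component; the products that are not listed are zero. -/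
def IsCocycleTwo (φ : (Fin n → K) →ₗ[K] (Fin n → K) →ₗ[K] (Fin n → K)) : Prop :=
  IsDeformationCocycle φ ∧
  (∃ a : ℕ → ℕ → ℕ → K, ∀ i j, FreeIndex (n - 1) i j → (i, j) ≠ (2, 4) →
    φ (stdX K n i) (stdX K n j) =
      ∑ k ∈ Finset.Icc 1 2, a i j (2 * k + 1) • stdX K n (2 * k + 1)) ∧
  φ (stdX K n 2) (stdX K n 4) = stdX K n n ∧
  (∀ i j, 1 ≤ i → i < j → j ≤ n → (i, j) ≠ (2, 4) → ¬ FreeIndex (n - 1) i j →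
    φ (stdX K n i) (stdX K n j) = 0)

variable (K n)

/-- The brackets `μ₀ + φ` of `familyF`, with `φ` a cocycle of the first kind. -/
def componentOne : Set (LieBracketOn K n) :=
  {μ | μ ∈ familyF K n ∧ ∃ φ, IsCocycleOne φ ∧ μ.toBilin = mu0 K n + φ}

/-- The brackets `μ₀ + φ` of `familyF`, with `φ` a cocycle of the second kind. -/
def componentTwo : Set (LieBracketOn K n) :=
  {μ | μ ∈ familyF K n ∧ ∃ φ, IsCocycleTwo φ ∧ μ.toBilin = mu0 K n + φ}

end Families

end

/-! An element X realising the characteristic sequence has Y, Z with [X,Y] and [X,Z] independent.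
Since the breadth is 2, these two brackets span the image of ad X.

The algebra is 2-step nilpotent. If (ad Y)² ≠ 0 for some Y outside the derived algebra, then, ad Y
having rank at most 2, its Jordan type is (3,1,…,1), which exceeds (2,2,1,…,1). So (ad Y)² = 0 off
the derived algebra, and then everywhere because the condition is quadratic in Y. In characteristic
0, 2-Engel implies 2-step (`lie_lie_eq_zero_of_engel_two`).

The main tool is a pencil argument (`exists_eq_of_pencil_finrank_range_le_two`): ad X + t ad W has
rank at most 2 for every t, so ad W sends the centralizer of X into im ad X. Two cases follow
(`derived_or_center_of_lieBreadth_eq_two`). If [Y,Z] lies in im ad X, the whole derived algebra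
does, and a basis starting with X, Y, [X,Y], Z, [X,Z] gives a bracket of the first family. Otherwise
X, Y, Z span the algebra modulo its centre, which makes it the free 2-step nilpotent algebra on
three generators plus an abelian summand. This is the member of the second family with all
parameters zero. -/

/-! ### Linear algebra: adapted bases, operators of rank at most two -/

/-- A linearly independent family extends to a basis by vectors of any submodule which, together
with the family, spans the whole space. -/
theorem exists_basis_extending {K V : Type*} [Field K] [AddCommGroup V] [Module K V]
    [FiniteDimensional K V] {n k : ℕ} (hn : finrank K V = n) {v : Fin k → V}
    (hv : LinearIndependent K v) (N : Submodule K V)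
    (hN : Submodule.span K (Set.range v) ⊔ N = ⊤) :
    k ≤ n ∧ ∃ b : Basis (Fin n) K V,
      (∀ (i : Fin n) (hi : (i : ℕ) < k), b i = v ⟨i, hi⟩) ∧ ∀ i : Fin n, k ≤ i → b i ∈ N := by
  set S := Submodule.span K (Set.range v) with hS
  have hfS : finrank K S = k := by rw [finrank_span_eq_card hv]; simp
  have hfQ : finrank K (V ⧸ S) + k = n := by rw [← hfS, ← hn]; exact S.finrank_quotient_add_finrank
  obtain ⟨m, hm⟩ : ∃ m, finrank K (V ⧸ S) = m := ⟨_, rfl⟩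
  rw [hm] at hfQ
  let q := finBasisOfFinrankEq K (V ⧸ S) hm
  -- Since N and the span S generate V, the submodule N surjects onto V/S, so a basis of V/S lifts
  -- to N.
  have hlift : ∀ j, ∃ w ∈ N, S.mkQ w = q j := by
    intro j
    obtain ⟨x, hx⟩ := S.mkQ_surjective (q j)
    have : x ∈ S ⊔ N := hN ▸ Submodule.mem_top
    obtain ⟨s, hs, w, hw, rfl⟩ := Submodule.mem_sup.1 this
    refine ⟨w, hw, ?_⟩
    rw [← hx, map_add, show S.mkQ s = 0 from (Submodule.Quotient.mk_eq_zero S).2 hs, zero_add]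
  choose w hwN hwq using hlift
  have hli : LinearIndependent K (Sum.elim v w) := by
    have h1 : LinearIndependent K (fun i => (⟨v i, Submodule.subset_span ⟨i, rfl⟩⟩ : S)) :=
      LinearIndependent.of_comp S.subtype hv
    refine LinearIndependent.sumElim_of_quotient h1 w ?_
    have hq : Submodule.Quotient.mk (p := S) ∘ w = q := funext hwq
    rw [hq]
    exact q.linearIndependent
  let e : Fin k ⊕ Fin m ≃ Fin n := finSumFinEquiv.trans (finCongr (by omega))
  have hli' : LinearIndependent K (Sum.elim v w ∘ e.symm) := hli.comp _ e.symm.injective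
  refine ⟨by omega, basisOfLinearIndependentOfCardEqFinrank' _ hli' (by simp [hn]), ?_, ?_⟩
  · intro i hi
    have : e.symm i = Sum.inl ⟨i, hi⟩ := by
      rw [Equiv.symm_apply_eq]; ext; simp [e]
    simp [this]
  · intro i hi
    have : e.symm i = Sum.inr ⟨i - k, by omega⟩ := by
      rw [Equiv.symm_apply_eq]; ext; simp [e]; omega
    simp [this, hwN]

theorem linearIndependent_triple_iff {K V : Type*} [Field K] [AddCommGroup V] [Module K V]
    {a b c : V} : LinearIndependent K ![a, b, c] ↔
      ∀ p q r : K, p • a + q • b + r • c = 0 → p = 0 ∧ q = 0 ∧ r = 0 := by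
  rw [Fintype.linearIndependent_iff]
  constructor
  · intro h p q r hs
    have := h ![p, q, r] (by simpa [Fin.sum_univ_three] using hs)
    exact ⟨this 0, this 1, this 2⟩
  · intro h g hs
    have := h (g 0) (g 1) (g 2) (by simpa [Fin.sum_univ_three] using hs)
    intro i
    fin_cases i <;> simp [this]

theorem linearIndependent_triple_of_notMem {K V : Type*} [Field K] [AddCommGroup V] [Module K V]
    {a b c : V} (hab : LinearIndependent K ![a, b]) (hc : ¬ ∃ p q : K, c = p • a + q • b) :
    LinearIndependent K ![a, b, c] := by
  rw [LinearIndependent.pair_iff] at hab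
  rw [linearIndependent_triple_iff]
  intro p q r h
  have hr : r = 0 := by
    by_contra hr
    refine hc ⟨-(r⁻¹ * p), -(r⁻¹ * q), ?_⟩
    have : c = r⁻¹ • (r • c) := by rw [smul_smul, inv_mul_cancel₀ hr, one_smul]
    rw [this, eq_neg_of_add_eq_zero_right h]
    module
  subst hr
  obtain ⟨h1, h2⟩ := hab p q (by simpa using h)
  exact ⟨h1, h2, rfl⟩

section RankTwo

variable {K V W : Type*} [Field K] [AddCommGroup V] [Module K V] [AddCommGroup W] [Module K W]
  [FiniteDimensional K W]

theorem not_linearIndependent_of_finrank_range_le_two {A : V →ₗ[K] W}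
    (hA : finrank K (LinearMap.range A) ≤ 2) (x y z : V) :
    ¬ LinearIndependent K ![A x, A y, A z] := by
  intro h
  have h1 := finrank_span_eq_card h
  have h2 : Submodule.span K (Set.range ![A x, A y, A z]) ≤ LinearMap.range A := by
    rw [Submodule.span_le]
    rintro _ ⟨i, rfl⟩
    fin_cases i
    exacts [⟨x, rfl⟩, ⟨y, rfl⟩, ⟨z, rfl⟩]
  have h3 := Submodule.finrank_mono h2
  simp at h1
  omega

theorem exists_eq_of_finrank_range_le_two {A : V →ₗ[K] W}
    (hA : finrank K (LinearMap.range A) ≤ 2) {x y : V} (h : LinearIndependent K ![A x, A y])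
    (z : V) : ∃ p q : K, A z = p • A x + q • A y := by
  by_contra hz
  exact not_linearIndependent_of_finrank_range_le_two hA x y z
    (linearIndependent_triple_of_notMem h hz)

/-- If all the members of the pencil `A + t B` have rank at most `2 = rank A`, then `B` maps the
kernel of `A` into the range of `A`. -/
theorem exists_eq_of_pencil_finrank_range_le_two [CharZero K] {A B : V →ₗ[K] W}
    (hAB : ∀ t : K, finrank K (LinearMap.range (A + t • B)) ≤ 2) {x y : V}
    (h : LinearIndependent K ![A x, A y]) {z : V} (hz : A z = 0) :
    ∃ p q : K, B z = p • A x + q • A y := by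
  by_contra hc
  have hli := linearIndependent_triple_of_notMem h hc
  obtain ⟨hk, b, hb, -⟩ := exists_basis_extending rfl hli ⊤ (by simp)
  set f := b.coord ⟨0, by omega⟩
  set g := b.coord ⟨1, by omega⟩
  have b0 := hb ⟨0, by omega⟩ (by simp)
  have b1 := hb ⟨1, by omega⟩ (by simp)
  have b2 := hb ⟨2, by omega⟩ (by simp)
  simp only [Fin.mk_zero, Fin.mk_one, Fin.reduceFinMk, Matrix.cons_val] at b0 b1 b2
  have f0 : f (A x) = 1 := by rw [← b0]; simp [f]
  have f1 : f (A y) = 0 := by rw [← b1]; simp [f]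
  have f2 : f (B z) = 0 := by rw [← b2]; simp [f]
  have g0 : g (A x) = 0 := by rw [← b0]; simp [g]
  have g1 : g (A y) = 1 := by rw [← b1]; simp [g]
  have g2 : g (B z) = 0 := by rw [← b2]; simp [g]
  have hB : B z ≠ 0 := fun h0 => hc ⟨0, 0, by simp [h0]⟩
  -- The coordinates f, g both vanish on B z, so a nonzero (f, g)-minor of the images of x and y
  -- would make these independent of (A + tB) z = t B z, giving rank 3.
  have hdet : ∀ t : K, t ≠ 0 →
      (1 + t * f (B x)) * (1 + t * g (B y)) - t * f (B y) * (t * g (B x)) = 0 := by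
    intro t ht
    by_contra hd
    refine not_linearIndependent_of_finrank_range_le_two (hAB t) x y z ?_
    rw [linearIndependent_triple_iff]
    intro p q r hs
    have hf := congrArg f hs
    have hg := congrArg g hs
    simp only [LinearMap.add_apply, LinearMap.smul_apply, map_add, map_smul, smul_eq_mul, map_zero,
      f0, f1, f2, g0, g1, g2, hz] at hf hg
    have hp : p = 0 := by
      refine (mul_eq_zero.1 ?_).resolve_left hd
      linear_combination (1 + t * g (B y)) * hf - t * f (B y) * hg
    have hq : q = 0 := by
      refine (mul_eq_zero.1 ?_).resolve_left hd
      linear_combination (1 + t * f (B x)) * hg - t * g (B x) * hf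
    subst hp hq
    simpa [hz, ht, hB] using hs
  have h1 := hdet 1 one_ne_zero
  have h2 := hdet (-1) (by simp)
  have h3 := hdet 2 two_ne_zero
  -- The minor is P(t) = 1 + st + dt², and 3P(1) + P(-1) - P(2) = 3 whatever s and d are.
  have : (3 : K) = 0 := by linear_combination 3 * h1 + h2 - h3
  exact three_ne_zero this

end RankTwo

/-! ### Jordan types -/

/-- A basis adapted to the Jordan type `(3,1,…,1)`. -/
theorem isNilpotentJordanType_three_ones {K V : Type*} [Field K] [AddCommGroup V] [Module K V]
    [FiniteDimensional K V] {A : V →ₗ[K] V} (hA : finrank K (LinearMap.range A) ≤ 2) {y : V}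
    (h2 : A (A y) ≠ 0) (h3 : A (A (A y)) = 0) :
    ∃ m, IsNilpotentJordanType A (3 :: List.replicate m 1) := by
  have hp : LinearIndependent K ![A y, A (A y)] := by
    rw [LinearIndependent.pair_iff]
    intro s t hst
    have hs : s = 0 := by
      have := congrArg A hst
      simpa [h3, h2] using this
    subst hs
    simpa [h2] using hst
  have ht : LinearIndependent K ![y, A y, A (A y)] := by
    rw [linearIndependent_triple_iff]
    intro p q r h
    have := congrArg A h
    simp only [map_add, map_smul, h3, smul_zero, add_zero, map_zero] at this
    obtain ⟨rfl, rfl⟩ := LinearIndependent.pair_iff.1 hp _ _ this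
    simpa [h2] using h
  -- The vectors A y, A² y span the range of A, so every vector agrees modulo ker A with a
  -- combination of y and A y. The remaining basis vectors can thus be taken in ker A, as blocks of
  -- size 1.
  obtain ⟨hn, b, hb, hbN⟩ := exists_basis_extending rfl ht (LinearMap.ker A) (by
    rw [eq_top_iff]
    intro x _
    obtain ⟨p, q, hpq⟩ := exists_eq_of_finrank_range_le_two hA hp x
    rw [Submodule.mem_sup]
    refine ⟨p • y + q • A y, ?_, x - (p • y + q • A y), ?_, by abel⟩
    · exact add_mem (Submodule.smul_mem _ _ (Submodule.subset_span ⟨0, rfl⟩))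
        (Submodule.smul_mem _ _ (Submodule.subset_span ⟨1, rfl⟩))
    · simp [hpq])
  obtain ⟨m, hm⟩ := Nat.exists_eq_add_of_le hn
  have hsorted : (3 :: List.replicate m 1).Pairwise (fun p q => q ≤ p) := by
    rw [List.pairwise_cons]
    refine ⟨fun a ha => ?_, List.pairwise_replicate.2 (Or.inr le_rfl)⟩
    rw [List.eq_of_mem_replicate ha]; norm_num
  have hone : ∀ k : Fin (List.replicate m 1).length,
      (3 :: List.replicate m 1).get k.succ = 1 := by intro k; simp
  -- Flattened index: entry j of the block of size 3 goes to j, and block i ≥ 1 goes to i + 2.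
  let F : (Σ i : Fin (3 :: List.replicate m 1).length, Fin ((3 :: List.replicate m 1).get i)) →
      Fin (finrank K V) := fun s => ⟨if (s.1 : ℕ) = 0 then (s.2 : ℕ) else s.1 + 2, by
        obtain ⟨i, j⟩ := s
        refine Fin.cases (fun j => ?_) (fun i j => ?_) i j
        · have : (j : ℕ) < 3 := j.2
          simp; omega
        · have := i.2
          simp at this ⊢; omega⟩
  have hF : Function.Bijective F := by
    constructor
    · rintro ⟨i, j⟩ ⟨i', j'⟩ h
      replace h := congrArg Fin.val h
      simp only [F] at h
      revert j j'
      refine Fin.cases (fun j => ?_) (fun i j => ?_) i <;>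
        refine Fin.cases (fun j' => ?_) (fun i' j' => ?_) i'
      · intro h
        simp at h
        exact congrArg (Sigma.mk _) (Fin.ext h)
      · intro h
        have : (j : ℕ) < 3 := j.2
        simp at h; omega
      · intro h
        have : (j' : ℕ) < 3 := j'.2
        simp at h; omega
      · intro h
        simp at h
        have h1 := Fin.ext h
        subst h1
        have : Subsingleton (Fin ((3 :: List.replicate m 1).get i.succ)) := by
          rw [hone]; infer_instance
        rw [Subsingleton.elim j j']
    · intro x
      by_cases hx : (x : ℕ) < 3
      · exact ⟨⟨⟨0, by simp⟩, ⟨x, hx⟩⟩, by apply Fin.ext; simp [F]⟩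
      · have hl : (x : ℕ) - 3 < (List.replicate m 1).length := by simp; omega
        refine ⟨⟨Fin.succ ⟨x - 3, hl⟩, ⟨0, by rw [hone]; norm_num⟩⟩, ?_⟩
        apply Fin.ext
        simp [F]; omega
  refine ⟨m, hsorted, by simp, b.reindex (Equiv.ofBijective F hF).symm, ?_⟩
  intro i j
  simp only [Basis.reindex_apply, Equiv.symm_symm, Equiv.ofBijective_apply]
  revert j
  refine Fin.cases (fun j => ?_) (fun i j => ?_) i
  · have hj : (j : ℕ) < 3 := j.2
    have key : ∀ l : Fin ((3 :: List.replicate m 1).get 0), ∀ hl : (l : ℕ) < 3,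
        b (F ⟨0, l⟩) = ![y, A y, A (A y)] ⟨l, hl⟩ := fun l hl => hb _ hl
    rw [key j hj]
    obtain ⟨j, hj'⟩ := j
    split_ifs with h
    · rw [key _ h]
      have : j = 0 ∨ j = 1 := by
        have : j + 1 < 3 := h
        omega
      rcases this with rfl | rfl <;> simp
    · have : j = 2 := by
        have : ¬ (j + 1 < 3) := h
        simp at hj
        omega
      subst this
      simp [h3]
  · rw [dif_neg (by have := j.2; have := hone i; omega)]
    have := hbN (F ⟨i.succ, j⟩) (by simp [F])
    exact this

section JordanType

variable {K V : Type*} [Field K] [AddCommGroup V] [Module K V]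

/-- The heads of the two chains of length 2 are sent to their ends, two distinct basis vectors. -/
theorem IsNilpotentJordanType.exists_linearIndependent_pair {f : V →ₗ[K] V} {l : List ℕ}
    (h : IsNilpotentJordanType f (2 :: 2 :: l)) : ∃ x y, LinearIndependent K ![f x, f y] := by
  obtain ⟨-, -, b, hb⟩ := h
  have h0 := hb ⟨0, by simp⟩ ⟨0, by simp⟩
  have h1 := hb ⟨1, by simp⟩ ⟨0, by simp⟩
  rw [dif_pos (by simp)] at h0 h1
  refine ⟨b ⟨⟨0, by simp⟩, ⟨0, by simp⟩⟩, b ⟨⟨1, by simp⟩, ⟨0, by simp⟩⟩, ?_⟩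
  · rw [h0, h1]
    convert b.linearIndependent.comp ![⟨⟨0, by simp⟩, ⟨1, by simp⟩⟩, ⟨⟨1, by simp⟩, ⟨1, by simp⟩⟩] ?_
      using 1
    · funext i
      fin_cases i <;> rfl
    · intro i j h
      have := congrArg (fun s => (s.1 : ℕ)) h
      fin_cases i <;> fin_cases j <;> simp at this ⊢

theorem IsNilpotentJordanType.conj {W : Type*} [AddCommGroup W] [Module K W] {f : V →ₗ[K] V}
    {g : W →ₗ[K] W} {c : List ℕ} (h : IsNilpotentJordanType f c) (e : V ≃ₗ[K] W)
    (he : ∀ x, g (e x) = e (f x)) : IsNilpotentJordanType g c := by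
  obtain ⟨h1, h2, b, hb⟩ := h
  refine ⟨h1, h2, b.map e, fun i j => ?_⟩
  rw [Basis.map_apply, he, hb]
  split_ifs <;> simp

end JordanType

/-- Replace x by its last iterate under A whose image by A² is still nonzero. The result heads a
chain of length exactly 3. -/
theorem exists_apply_ne_zero_of_isNilpotent {K V : Type*} [Field K] [AddCommGroup V] [Module K V]
    {A : V →ₗ[K] V} (hA : IsNilpotent A) {x : V} (hx : A (A x) ≠ 0) :
    ∃ y, A (A y) ≠ 0 ∧ A (A (A y)) = 0 := by
  obtain ⟨k, hk⟩ := hA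
  have key : ∀ j x, A (A x) ≠ 0 → (A ^ j) (A (A x)) = 0 → ∃ y, A (A y) ≠ 0 ∧ A (A (A y)) = 0 := by
    intro j
    induction j with
    | zero => exact fun x hx h => absurd h hx
    | succ j ih =>
      intro x hx h
      by_cases h' : A (A (A x)) = 0
      · exact ⟨x, hx, h'⟩
      · exact ih (A x) h' (by rwa [pow_succ] at h)
  exact key k x hx (by rw [hk]; rfl)

/-! ### Two-step nilpotency and the structure of breadth two -/

section Lie

variable {K L : Type*} [Field K] [LieRing L] [LieAlgebra K L]

theorem finrank_range_ad_le_lieBreadth [FiniteDimensional K L] (X : L) :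
    finrank K (LinearMap.range (LieAlgebra.ad K L X)) ≤ lieBreadth K L :=
  le_csSup ⟨finrank K L, by rintro _ ⟨Y, rfl⟩; exact Submodule.finrank_le _⟩ ⟨X, rfl⟩

/-- A `2`-Engel Lie algebra in characteristic zero is `2`-step nilpotent. -/
theorem lie_lie_eq_zero_of_engel_two [CharZero K] (h : ∀ x y : L, ⁅x, ⁅x, y⁆⁆ = 0) (x y z : L) :
    ⁅⁅x, y⁆, z⁆ = 0 := by
  have h1 : ∀ x y z : L, ⁅x, ⁅y, z⁆⁆ = -⁅y, ⁅x, z⁆⁆ := by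
    intro x y z
    have := h (x + y) z
    simp only [add_lie, lie_add, h, zero_add, add_zero] at this
    exact eq_neg_of_add_eq_zero_left (by rwa [add_comm] at this)
  have h2 : ∀ x y z : L, ⁅x, ⁅y, z⁆⁆ = -⁅x, ⁅z, y⁆⁆ := by
    intro x y z
    rw [← lie_skew y z, lie_neg]
  -- By `h1` and `h2` the triple bracket T = [x,[y,z]] is alternating, so the Jacobi identity reads
  -- T = -T - T.
  have h3 : (3 : K) • ⁅x, ⁅y, z⁆⁆ = 0 := by
    have e1 := leibniz_lie x y z
    have e2 : ⁅⁅x, y⁆, z⁆ = -⁅x, ⁅y, z⁆⁆ := by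
      rw [← lie_skew, h1 z x y, h2 x z y]; simp
    rw [e2, h1 y x z] at e1
    have : (3 : K) • ⁅x, ⁅y, z⁆⁆ = ⁅x, ⁅y, z⁆⁆ + ⁅x, ⁅y, z⁆⁆ + ⁅x, ⁅y, z⁆⁆ := by module
    rw [this]
    nth_rw 1 [e1]
    abel
  have h4 : ⁅x, ⁅y, z⁆⁆ = 0 := (smul_eq_zero.1 h3).resolve_left three_ne_zero
  rw [← lie_skew, h1 z x y, h2 x z y, h4]; simp

/-- A nilpotent Lie algebra of breadth `2` and characteristic sequence `(2,2,1,…,1)` is `2`-step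
nilpotent. -/
theorem lie_lie_eq_zero_of_isCharacteristicSequence [CharZero K] [FiniteDimensional K L]
    [LieRing.IsNilpotent L] {n : ℕ} (hb : lieBreadth K L = 2)
    (hc : IsCharacteristicSequence K L (seqTwoTwoOnes n)) (x y z : L) : ⁅⁅x, y⁆, z⁆ = 0 := by
  refine lie_lie_eq_zero_of_engel_two (K := K) ?_ x y z
  obtain ⟨⟨X, hX, hXc⟩, hmax⟩ := hc
  -- Otherwise ad Y has type (3,1,…,1); the first entries 3 > 2 already contradict maximality,
  -- whatever the number of ones.
  have houter : ∀ Y : L, Y ∉ (⁅(⊤ : LieIdeal K L), (⊤ : LieIdeal K L)⁆ : LieIdeal K L) →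
      ∀ z : L, ⁅Y, ⁅Y, z⁆⁆ = 0 := by
    intro Y hY z
    by_contra hz
    have hnil : IsNilpotent (LieAlgebra.ad K L Y) := by
      obtain ⟨k, hk⟩ := LieAlgebra.nilpotent_ad_of_nilpotent_algebra K L
      exact ⟨k, hk Y⟩
    obtain ⟨w, hw, hw'⟩ := exists_apply_ne_zero_of_isNilpotent hnil (x := z) hz
    obtain ⟨m, hm⟩ := isNilpotentJordanType_three_ones
      ((finrank_range_ad_le_lieBreadth Y).trans hb.le) hw hw'
    have := hmax ⟨Y, hY, hm⟩
    exact absurd this (not_le_of_gt (List.Lex.rel (by norm_num)))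
  intro Y z
  by_cases hY : Y ∈ (⁅(⊤ : LieIdeal K L), (⊤ : LieIdeal K L)⁆ : LieIdeal K L)
  -- Both Y + X and Y - X lie outside the derived algebra; adding their two identities cancels the
  -- mixed terms and leaves 2 (ad Y)² z = 0.
  · have h0 := houter X hX z
    have h1 := houter (Y + X) (fun h => hX (by simpa using sub_mem h hY)) z
    have h2 := houter (Y - X) (fun h => hX (by simpa using sub_mem hY h)) z
    simp only [add_lie, lie_add, sub_lie, lie_sub, h0] at h1 h2
    have h3 : (2 : K) • ⁅Y, ⁅Y, z⁆⁆ = 0 := by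
      rw [← add_zero (0 : L), ← congrArg₂ (· + ·) h1 h2]
      module
    exact (smul_eq_zero.1 h3).resolve_left two_ne_zero
  · exact houter Y hY z

/-- The structure of the `2`-step nilpotent Lie algebras of breadth `2`. -/
theorem derived_or_center_of_lieBreadth_eq_two [CharZero K] [FiniteDimensional K L]
    (hb : lieBreadth K L = 2) {X Y Z : L} (hXYZ : LinearIndependent K ![⁅X, Y⁆, ⁅X, Z⁆]) :
    (∀ u v : L, ∃ p q : K, ⁅u, v⁆ = p • ⁅X, Y⁆ + q • ⁅X, Z⁆) ∨
    (LinearIndependent K ![⁅X, Y⁆, ⁅X, Z⁆, ⁅Y, Z⁆] ∧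
      ∀ u, ∃ p q r : K, ∀ v : L, ⁅u - (p • X + q • Y + r • Z), v⁆ = 0) := by
  have hR : ∀ {x y z : L}, LinearIndependent K ![⁅x, y⁆, ⁅x, z⁆] → ∀ u : L, ∃ p q : K,
      ⁅x, u⁆ = p • ⁅x, y⁆ + q • ⁅x, z⁆ := fun {x y z} h u =>
    exists_eq_of_finrank_range_le_two (A := LieAlgebra.ad K L x) (x := y) (y := z)
      ((finrank_range_ad_le_lieBreadth x).trans hb.le) h u
  have hP : ∀ {x y z : L}, LinearIndependent K ![⁅x, y⁆, ⁅x, z⁆] → ∀ u : L, ⁅x, u⁆ = 0 → ∀ w : L,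
      ∃ p q : K, ⁅w, u⁆ = p • ⁅x, y⁆ + q • ⁅x, z⁆ := by
    intro x y z h u hu w
    refine exists_eq_of_pencil_finrank_range_le_two (A := LieAlgebra.ad K L x)
      (B := LieAlgebra.ad K L w) (x := y) (y := z) (fun t => ?_) h hu
    rw [← map_smul, ← map_add]
    exact (finrank_range_ad_le_lieBreadth _).trans hb.le
  by_cases hw : ∃ p q : K, ⁅Y, Z⁆ = p • ⁅X, Y⁆ + q • ⁅X, Z⁆
  · left
    obtain ⟨a, b, hw⟩ := hw
    have hker : ∀ u : L, ∃ p q : K, ⁅X, u - (p • Y + q • Z)⁆ = 0 := by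
      intro u
      obtain ⟨p, q, h⟩ := hR hXYZ u
      exact ⟨p, q, by simp [h]⟩
    intro u v
    obtain ⟨p, q, h⟩ := hker u
    obtain ⟨p', q', h'⟩ := hker v
    set u' := u - (p • Y + q • Z)
    obtain ⟨r, s, hrs⟩ := hP hXYZ u' h v
    obtain ⟨r', s', hrs'⟩ := hP hXYZ _ h' (p • Y + q • Z)
    refine ⟨-r + r' + (p * q' - q * p') * a, -s + s' + (p * q' - q * p') * b, ?_⟩
    -- The first two terms involve an element of the centralizer of X, so the pencil argument puts
    -- them in im ad X; the last is a multiple of [Y,Z].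
    have e1 : ⁅u, v⁆ = -⁅v, u'⁆ + ⁅p • Y + q • Z, v - (p' • Y + q' • Z)⁆
        + ⁅p • Y + q • Z, p' • Y + q' • Z⁆ := by
      rw [lie_skew, lie_sub]
      simp only [u', sub_lie]
      abel
    have e2 : ⁅p • Y + q • Z, p' • Y + q' • Z⁆ = (p * q' - q * p') • ⁅Y, Z⁆ := by
      simp only [add_lie, lie_add, smul_lie, lie_smul, lie_self, ← lie_skew Y Z]
      module
    rw [e1, e2, hrs, hrs', hw]
    module
  · right
    have hli := linearIndependent_triple_of_notMem hXYZ hw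
    refine ⟨hli, ?_⟩
    have hli' := linearIndependent_triple_iff.1 hli
    have hY : LinearIndependent K ![⁅Y, X⁆, ⁅Y, Z⁆] := by
      rw [LinearIndependent.pair_iff]
      intro s t h
      rw [← lie_skew] at h
      obtain ⟨h1, -, h2⟩ := hli' (-s) 0 t (by rw [← h]; module)
      exact ⟨neg_eq_zero.1 h1, h2⟩
    have hZ : LinearIndependent K ![⁅Z, X⁆, ⁅Z, Y⁆] := by
      rw [LinearIndependent.pair_iff]
      intro s t h
      rw [← lie_skew, ← lie_skew Z Y] at h
      obtain ⟨-, h1, h2⟩ := hli' 0 (-s) (-t) (by rw [← h]; module)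
      exact ⟨neg_eq_zero.1 h1, neg_eq_zero.1 h2⟩
    -- The element Y + Z gives the one constraint not visible on X, Y, Z: it removes the
    -- [X,Z]-component left in [Z,u'].
    have hYZ : LinearIndependent K ![⁅Y + Z, X⁆, ⁅Y + Z, Z⁆] := by
      rw [LinearIndependent.pair_iff]
      intro s t h
      simp only [add_lie, lie_self, ← lie_skew Y X, ← lie_skew Z X] at h
      obtain ⟨h1, -, h2⟩ := hli' (-s) (-s) t (by rw [← h]; module)
      exact ⟨neg_eq_zero.1 h1, h2⟩
    have hC : ∀ u : L, ∃ p q r : K, ⁅X, u - (p • X + q • Y + r • Z)⁆ = 0 ∧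
        ⁅Y, u - (p • X + q • Y + r • Z)⁆ = 0 ∧ ⁅Z, u - (p • X + q • Y + r • Z)⁆ = 0 := by
      intro u
      obtain ⟨q, r, h1⟩ := hR hXYZ u
      obtain ⟨a, a', ha⟩ := hR hY (u - (q • Y + r • Z))
      obtain ⟨c, c', hc⟩ := hP hXYZ (u - (q • Y + r • Z)) (by simp [h1]) Y
      -- The bracket of Y with the corrected u lies in im ad Y ∩ im ad X, the line of [X,Y], so
      -- subtracting a multiple of X kills it.
      have e := ha.symm.trans hc
      rw [← lie_skew Y X] at e
      obtain ⟨-, -, rfl⟩ := hli' (-a - c) (-c') a' (by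
        rw [← sub_eq_zero] at e; rw [← e]; module)
      set u' := u - (a • X + q • Y + r • Z) with hu'
      have hXu : ⁅X, u'⁆ = 0 := by simp [hu', h1]
      have hYu : ⁅Y, u'⁆ = 0 := by
        have : u' = u - (q • Y + r • Z) - a • X := by rw [hu']; abel
        rw [this, lie_sub, ha]; simp
      obtain ⟨d, d', hd⟩ := hP hXYZ u' hXu Z
      obtain ⟨f, f', hf⟩ := hR hZ u'
      -- Likewise [Z,u'] lies in the line of [X,Z]. Since [Y,u'] = 0, it equals [Y+Z,u'], which lies
      -- in the span of [X,Y] + [X,Z] and [Y,Z]; hence it is zero.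
      have e' := hf.symm.trans hd
      rw [← lie_skew Z X, ← lie_skew Z Y] at e'
      obtain ⟨h2, -, -⟩ := hli' (-d) (-f - d') (-f') (by
        rw [← sub_eq_zero] at e'; rw [← e']; module)
      obtain rfl : d = 0 := neg_eq_zero.1 h2
      obtain ⟨g, g', hg⟩ := hR hYZ u'
      simp only [add_lie, hYu, hd, lie_self, ← lie_skew Y X, ← lie_skew Z X] at hg
      obtain ⟨h3, h4, -⟩ := hli' g (d' + g) (-g') (by
        rw [← sub_eq_zero] at hg; rw [← hg]; module)
      subst h3
      obtain rfl : d' = 0 := by simpa using h4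
      exact ⟨a, q, r, hXu, hYu, by rw [hd]; simp⟩
    intro u
    obtain ⟨p, q, r, h1, h2, h3⟩ := hC u
    refine ⟨p, q, r, fun v => ?_⟩
    set u' := u - (p • X + q • Y + r • Z)
    obtain ⟨p', q', r', h1', h2', h3'⟩ := hC v
    have hv : ⁅u', v⁆ = ⁅u', v - (p' • X + q' • Y + r' • Z)⁆ := by
      have e : ∀ w : L, ⁅w, u'⁆ = 0 → ⁅u', w⁆ = 0 := fun w hw' => by
        rw [← lie_skew, hw', neg_zero]
      simp [e X h1, e Y h2, e Z h3]
    rw [hv]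
    -- Two elements centralizing X, Y and Z have their bracket in the images of ad X, ad Y and ad Z,
    -- whose intersection is zero.
    obtain ⟨a, a', ha⟩ := hP hXYZ _ h1' u'
    obtain ⟨c, c', hc⟩ := hP hY _ h2' u'
    obtain ⟨d, d', hd⟩ := hP hZ _ h3' u'
    have e := ha.symm.trans hc
    have e' := ha.symm.trans hd
    rw [← lie_skew Y X] at e
    rw [← lie_skew Z X, ← lie_skew Z Y] at e'
    obtain ⟨-, ha', -⟩ := hli' (a + c) a' (-c') (by rw [← sub_eq_zero] at e; rw [← e]; module)
    obtain ⟨ha0, -, -⟩ := hli' a (a' + d) d' (by rw [← sub_eq_zero] at e'; rw [← e']; module)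
    rw [ha, ha0, ha']
    simp

end Lie

/-! ### Invariance under isomorphism and models on Kⁿ -/

section Transport

variable {K L L' : Type*} [Field K] [LieRing L] [LieAlgebra K L] [LieRing L'] [LieAlgebra K L']

theorem LieHom.map_mem_derived (f : L →ₗ⁅K⁆ L') {x : L}
    (hx : x ∈ (⁅(⊤ : LieIdeal K L), (⊤ : LieIdeal K L)⁆ : LieIdeal K L)) :
    f x ∈ (⁅(⊤ : LieIdeal K L'), (⊤ : LieIdeal K L')⁆ : LieIdeal K L') :=
  LieSubmodule.mono_lie le_top le_top (LieIdeal.map_bracket_le f (LieIdeal.mem_map hx))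

theorem LieEquiv.map_mem_derived_iff (e : L ≃ₗ⁅K⁆ L') {x : L} :
    e x ∈ (⁅(⊤ : LieIdeal K L'), (⊤ : LieIdeal K L')⁆ : LieIdeal K L') ↔
      x ∈ (⁅(⊤ : LieIdeal K L), (⊤ : LieIdeal K L)⁆ : LieIdeal K L) := by
  refine ⟨fun h => ?_, fun h => e.toLieHom.map_mem_derived h⟩
  have := e.symm.toLieHom.map_mem_derived h
  simpa using this

theorem IsCharacteristicSequence.of_lieEquiv (e : L ≃ₗ⁅K⁆ L') {c : List ℕ}
    (h : IsCharacteristicSequence K L c) : IsCharacteristicSequence K L' c := by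
  obtain ⟨⟨X, hX, hXc⟩, hmax⟩ := h
  refine ⟨⟨e X, fun h => hX (e.map_mem_derived_iff.1 h), hXc.conj e.toLinearEquiv ?_⟩, ?_⟩
  · intro x
    exact (LieEquiv.map_lie e X x).symm
  · rintro d ⟨Y, hY, hYd⟩
    refine hmax ⟨e.symm Y, fun h => hY (e.symm.map_mem_derived_iff.1 h),
      hYd.conj e.symm.toLinearEquiv ?_⟩
    intro x
    exact (LieEquiv.map_lie e.symm Y x).symm

theorem nilpotencyLength_eq_two (h2 : ∀ x y z : L, ⁅⁅x, y⁆, z⁆ = 0) {x y : L} (hxy : ⁅x, y⁆ ≠ 0) :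
    LieModule.nilpotencyLength L L = 2 := by
  -- The nilpotency length does not refer to the scalars, so the lower central series may be taken
  -- over ℤ.
  rw [LieModule.nilpotencyLength_eq_succ_iff ℤ L L 1]
  constructor
  · rw [LieModule.lowerCentralSeries_succ, eq_bot_iff, LieSubmodule.lie_le_iff]
    intro u _ v hv
    rw [LieSubmodule.mem_bot]
    have : LieModule.lowerCentralSeries ℤ L L 1 ≤ LieAlgebra.center ℤ L := by
      rw [LieModule.lowerCentralSeries_succ, LieSubmodule.lie_le_iff]
      intro a _ b _
      rw [LieModule.mem_maxTrivSubmodule]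
      intro c
      rw [← lie_skew, h2, neg_zero]
    exact (LieModule.mem_maxTrivSubmodule ℤ L L v).1 (this hv) u
  · intro h
    apply hxy
    rw [← LieSubmodule.mem_bot (R := ℤ) (L := L), ← h, LieModule.lowerCentralSeries_succ]
    exact LieSubmodule.lie_mem_lie trivial trivial

end Transport

namespace LieBracketOn

variable {K L : Type*} [Field K] [LieRing L] [LieAlgebra K L] {n : ℕ}

/-- The bracket of a Lie algebra in the coordinates of a basis. -/
noncomputable def ofBasis (b : Basis (Fin n) K L) : LieBracketOn K n where
  toBilin := LinearMap.mk₂ K (fun x y => b.equivFun ⁅b.equivFun.symm x, b.equivFun.symm y⁆)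
    (fun x x' y => by simp only [map_add, add_lie])
    (fun t x y => by simp only [map_smul, smul_lie])
    (fun x y y' => by simp only [map_add, lie_add])
    (fun t x y => by simp only [map_smul, lie_smul])
  self x := by simp only [LinearMap.mk₂_apply, lie_self, map_zero]
  jacobi x y z := by
    simp only [LinearMap.mk₂_apply, LinearEquiv.symm_apply_apply, ← map_add]
    have h := lie_jacobi (b.equivFun.symm x) (b.equivFun.symm y) (b.equivFun.symm z)
    rw [← lie_skew _ ⁅b.equivFun.symm y, b.equivFun.symm z⁆,
      ← lie_skew _ ⁅b.equivFun.symm z, b.equivFun.symm x⁆,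
      ← lie_skew _ ⁅b.equivFun.symm x, b.equivFun.symm y⁆] at h
    rw [LinearEquiv.map_eq_zero_iff, ← neg_eq_zero, ← h]
    abel

theorem ofBasis_apply (b : Basis (Fin n) K L) (x y : Fin n → K) :
    (ofBasis b).toBilin x y = b.equivFun ⁅b.equivFun.symm x, b.equivFun.symm y⁆ := rfl

/-- A Lie algebra is isomorphic to its model in the coordinates of a basis. -/
noncomputable def ofBasisEquiv (b : Basis (Fin n) K L) : L ≃ₗ⁅K⁆ (ofBasis b).Alg :=
  { (b.equivFun : L ≃ₗ[K] (Fin n → K)) with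
    map_lie' := fun {x y} => by
      change b.equivFun ⁅x, y⁆ = b.equivFun ⁅b.equivFun.symm (b.equivFun x),
        b.equivFun.symm (b.equivFun y)⁆
      simp only [LinearEquiv.symm_apply_apply] }

theorem ofBasis_mem_familyF (b : Basis (Fin n) K L) (h2 : ∀ x y z : L, ⁅⁅x, y⁆, z⁆ = 0) {x y : L}
    (hxy : ⁅x, y⁆ ≠ 0) (hc : IsCharacteristicSequence K L (seqTwoTwoOnes n)) :
    ofBasis b ∈ familyF K n := by
  let e := ofBasisEquiv b
  refine ⟨nilpotencyLength_eq_two (fun x y z => ?_) (x := e x) (y := e y) ?_,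
    hc.of_lieEquiv e⟩
  · have : e.symm ⁅⁅x, y⁆, z⁆ = 0 := by rw [LieEquiv.map_lie, LieEquiv.map_lie, h2]
    rw [← e.apply_symm_apply ⁅⁅x, y⁆, z⁆, this]
    exact map_zero e.toLinearEquiv
  · rw [← LieEquiv.map_lie]
    exact fun h => hxy ((LinearEquiv.map_eq_zero_iff e.toLinearEquiv).1 h)

end LieBracketOn

/-! ### Coordinates and membership in the two families -/

section Coordinates

variable {K : Type*} [Field K] {n : ℕ}

theorem coordX_stdX {k : ℕ} (hk : 1 ≤ k) (hkn : k ≤ n) (i : ℕ) :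
    coordX K n k (stdX K n i) = if k = i then 1 else 0 := by
  rw [coordX, LinearMap.sum_apply, Finset.sum_eq_single ⟨k - 1, by omega⟩]
  · rw [if_pos (by simp; omega)]
    simp [stdX, hk]
  · intro j _ hj
    rw [if_neg, LinearMap.zero_apply]
    intro h
    exact hj (Fin.ext (by simp; omega))
  · simp

theorem coordX_stdX_of_ne {k i : ℕ} (h : k ≠ i) : coordX K n k (stdX K n i) = 0 := by
  rw [coordX, LinearMap.sum_apply]
  refine Finset.sum_eq_zero fun j _ => ?_
  split_ifs with hj
  · rw [LinearMap.proj_apply, stdX, if_neg (by omega)]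
  · rfl

theorem mu0_apply (x y : Fin n → K) :
    mu0 K n x y = (coordX K n 1 x * coordX K n 2 y - coordX K n 2 x * coordX K n 1 y) • stdX K n 3
      + (coordX K n 1 x * coordX K n 4 y - coordX K n 4 x * coordX K n 1 y) • stdX K n 5 := by
  have : Finset.Icc 1 2 = {1, 2} := rfl
  rw [mu0, this, Finset.sum_pair (by norm_num)]
  rfl

theorem mu0_eq_zero {x : Fin n → K} (h1 : coordX K n 1 x = 0) (h2 : coordX K n 2 x = 0)
    (h4 : coordX K n 4 x = 0) (y : Fin n → K) : mu0 K n x y = 0 := by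
  simp [mu0_apply, h1, h2, h4]

theorem mu0_skew (x y : Fin n → K) : mu0 K n x y = -mu0 K n y x := by
  simp only [mu0_apply]
  module

end Coordinates

namespace LieBracketOn

variable {K : Type*} [Field K] {n : ℕ} {μ : LieBracketOn K n}

/-- The values of μ₀ lie in the span of X₃ and X₅, which is central for μ and for μ₀, and the values
of μ are central for both. Hence every composition of the two brackets vanishes. -/
theorem isDeformationCocycle_sub_mu0 (h2 : ∀ x y z, μ.toBilin (μ.toBilin x y) z = 0)
    (h3 : ∀ z, μ.toBilin (stdX K n 3) z = 0) (h5 : ∀ z, μ.toBilin (stdX K n 5) z = 0)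
    (hc : ∀ x y z, mu0 K n (μ.toBilin x y) z = 0) :
    IsDeformationCocycle (μ.toBilin - mu0 K n) := by
  have hμ : ∀ x y z, μ.toBilin (mu0 K n x y) z = 0 := by
    intro x y z
    simp [mu0_apply x y, h3, h5]
  have h0 : ∀ x y z, mu0 K n (mu0 K n x y) z = 0 := by
    intro x y z
    refine mu0_eq_zero ?_ ?_ ?_ z <;> simp [mu0_apply x y, coordX_stdX_of_ne]
  refine ⟨fun x => ?_, fun x y z => ?_, fun x y z => ?_⟩
  · simp only [LinearMap.sub_apply, μ.self, mu0_apply]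
    module
  · simp [hμ, h0, hc]
  · simp [hμ, h0, hc, h2]

theorem mem_componentOne (hn : 5 ≤ n) (hμ : μ ∈ familyF K n)
    (h2 : ∀ x y z, μ.toBilin (μ.toBilin x y) z = 0)
    (h12 : μ.toBilin (stdX K n 1) (stdX K n 2) = stdX K n 3)
    (h14 : μ.toBilin (stdX K n 1) (stdX K n 4) = stdX K n 5)
    (h1 : ∀ j, 6 ≤ j → j ≤ n → μ.toBilin (stdX K n 1) (stdX K n j) = 0)
    (hspan : ∀ x y, ∃ p q : K, μ.toBilin x y = p • stdX K n 3 + q • stdX K n 5) :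
    μ ∈ componentOne K n := by
  have h3 : ∀ z, μ.toBilin (stdX K n 3) z = 0 := fun z => by rw [← h12, h2]
  have h5 : ∀ z, μ.toBilin (stdX K n 5) z = 0 := fun z => by rw [← h14, h2]
  have hm3 : ∀ z, mu0 K n (stdX K n 3) z = 0 := fun z => by
    refine mu0_eq_zero ?_ ?_ ?_ z <;> simp [coordX_stdX_of_ne]
  have hm5 : ∀ z, mu0 K n (stdX K n 5) z = 0 := fun z => by
    refine mu0_eq_zero ?_ ?_ ?_ z <;> simp [coordX_stdX_of_ne]
  refine ⟨hμ, μ.toBilin - mu0 K n, ⟨?_, ?_, ?_⟩, by abel⟩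
  · refine isDeformationCocycle_sub_mu0 h2 h3 h5 fun x y z => ?_
    obtain ⟨p, q, h⟩ := hspan x y
    simp [h, hm3, hm5]
  · refine ⟨fun i j k => coordX K n k (μ.toBilin (stdX K n i) (stdX K n j)), ?_⟩
    rintro i j ⟨hi, hij, -⟩
    obtain ⟨p, q, h⟩ := hspan (stdX K n i) (stdX K n j)
    have : Finset.Icc 1 2 = {1, 2} := rfl
    rw [this, Finset.sum_pair (by norm_num)]
    simp [h, mu0_apply, coordX_stdX_of_ne (show 1 ≠ i by omega),
      coordX_stdX_of_ne (show 1 ≠ j by omega), coordX_stdX (show 1 ≤ 3 by norm_num) (by omega : 3 ≤ n),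
      coordX_stdX (show 1 ≤ 5 by norm_num) hn]
  · intro i j hi hij hj hfree
    rw [LinearMap.sub_apply, LinearMap.sub_apply]
    by_cases hi3 : i = 3
    · simp [hi3, h3, hm3]
    by_cases hi5 : i = 5
    · simp [hi5, h5, hm5]
    by_cases hj3 : j = 3
    · rw [μ.skew, mu0_skew]; simp [hj3, h3, hm3]
    by_cases hj5 : j = 5
    · rw [μ.skew, mu0_skew]; simp [hj5, h5, hm5]
    obtain rfl : i = 1 := by
      by_contra h
      exact hfree ⟨by omega, hij, hj, hi3, hi5, hj3, hj5⟩
    rw [mu0_apply]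
    by_cases hj2 : j = 2
    · subst hj2
      simp [h12, coordX_stdX_of_ne, coordX_stdX (le_refl 1) (by omega : 1 ≤ n),
        coordX_stdX (show 1 ≤ 2 by norm_num) (by omega : 2 ≤ n)]
    by_cases hj4 : j = 4
    · subst hj4
      simp [h14, coordX_stdX_of_ne, coordX_stdX (le_refl 1) (by omega : 1 ≤ n),
        coordX_stdX (show 1 ≤ 4 by norm_num) (by omega : 4 ≤ n)]
    simp [h1 j (by omega) hj, coordX_stdX_of_ne, coordX_stdX_of_ne (show 1 ≠ j by omega),
      coordX_stdX_of_ne (show 2 ≠ j by omega), coordX_stdX_of_ne (show 4 ≠ j by omega)]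

/-- Only X₁, X₂, X₄ are non-central among the basis vectors, and μ₀ already accounts for the
brackets with X₁, so μ - μ₀ is carried by the pair (2,4) alone. -/
theorem mem_componentTwo (hn : 6 ≤ n) (hμ : μ ∈ familyF K n)
    (h12 : μ.toBilin (stdX K n 1) (stdX K n 2) = stdX K n 3)
    (h14 : μ.toBilin (stdX K n 1) (stdX K n 4) = stdX K n 5)
    (h24 : μ.toBilin (stdX K n 2) (stdX K n 4) = stdX K n n)
    (hcen : ∀ i, 1 ≤ i → i ≤ n → i ≠ 1 → i ≠ 2 → i ≠ 4 → ∀ z, μ.toBilin (stdX K n i) z = 0)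
    (hspan : ∀ x y, ∃ p q r : K,
      μ.toBilin x y = p • stdX K n 3 + q • stdX K n 5 + r • stdX K n n) :
    μ ∈ componentTwo K n := by
  have h3 := hcen 3 (by norm_num) (by omega) (by norm_num) (by norm_num) (by norm_num)
  have h5 := hcen 5 (by norm_num) (by omega) (by norm_num) (by norm_num) (by norm_num)
  have h6 := hcen n (by omega) le_rfl (by omega) (by omega) (by omega)
  have hm : ∀ i, i ≠ 1 → i ≠ 2 → i ≠ 4 → ∀ z, mu0 K n (stdX K n i) z = 0 := fun i h1 h2 h4 z =>
    mu0_eq_zero (coordX_stdX_of_ne h1.symm) (coordX_stdX_of_ne h2.symm)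
      (coordX_stdX_of_ne h4.symm) z
  have hφ : ∀ i j, 1 ≤ i → i < j → j ≤ n → (i, j) ≠ (2, 4) →
      (μ.toBilin - mu0 K n) (stdX K n i) (stdX K n j) = 0 := by
    intro i j hi hij hj hne
    rw [LinearMap.sub_apply, LinearMap.sub_apply]
    by_cases hi' : i = 1 ∨ i = 2 ∨ i = 4
    · by_cases hj' : j = 1 ∨ j = 2 ∨ j = 4
      · have : (i = 1 ∧ j = 2) ∨ (i = 1 ∧ j = 4) := by
          have : ¬ (i = 2 ∧ j = 4) := fun h => hne (by rw [h.1, h.2])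
          omega
        rw [mu0_apply]
        rcases this with ⟨rfl, rfl⟩ | ⟨rfl, rfl⟩
        · simp [h12, coordX_stdX_of_ne, coordX_stdX (le_refl 1) (by omega : 1 ≤ n),
            coordX_stdX (show 1 ≤ 2 by norm_num) (by omega : 2 ≤ n)]
        · simp [h14, coordX_stdX_of_ne, coordX_stdX (le_refl 1) (by omega : 1 ≤ n),
            coordX_stdX (show 1 ≤ 4 by norm_num) (by omega : 4 ≤ n)]
      · rw [μ.skew, mu0_skew, hcen j (by omega) hj (by omega) (by omega) (by omega),
          hm j (by omega) (by omega) (by omega)]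
        simp
    · rw [hcen i hi (by omega) (by omega) (by omega) (by omega),
        hm i (by omega) (by omega) (by omega), sub_zero]
  -- All the free parameters are zero, by `hφ`.
  refine ⟨hμ, μ.toBilin - mu0 K n, ⟨?_, ⟨0, ?_⟩, ?_, ?_⟩, by abel⟩
  · refine isDeformationCocycle_sub_mu0 (fun x y z => ?_) h3 h5 fun x y z => ?_
    · obtain ⟨p, q, r, h⟩ := hspan x y
      simp [h, h3, h5, h6]
    · obtain ⟨p, q, r, h⟩ := hspan x y
      simp [h, hm 3, hm 5, hm n (by omega) (by omega) (by omega)]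
  · rintro i j ⟨hi, hij, hj, -⟩ hne
    rw [hφ i j (by omega) hij (by omega) hne]
    simp
  · rw [LinearMap.sub_apply, LinearMap.sub_apply, h24, mu0_apply]
    simp [coordX_stdX_of_ne]
  · intro i j hi hij hj hne _
    exact hφ i j hi hij hj hne

end LieBracketOn

/-! ### Adapted bases and conclusion -/

theorem equivFun_symm_stdX {K V : Type*} [Field K] [AddCommGroup V] [Module K V] {n : ℕ}
    (b : Basis (Fin n) K V) {i : ℕ} (hi : 1 ≤ i) (hn : i ≤ n) :
    b.equivFun.symm (stdX K n i) = b ⟨i - 1, by omega⟩ := by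
  rw [Basis.equivFun_symm_apply, Finset.sum_eq_single ⟨i - 1, by omega⟩]
  · simp [stdX, hi]
  · intro j _ hj
    rw [stdX, if_neg, zero_smul]
    intro h
    exact hj (Fin.ext (by simp; omega))
  · simp

section Lie

variable {K L : Type*} [Field K] [LieRing L] [LieAlgebra K L]

/-- Applying ad X to a relation kills the coefficients of Y and Z, bracketing with Y then kills that
of X, and what remains is a relation between the two brackets. The order is that of X₁, …, X₅. -/
theorem linearIndependent_five (h2 : ∀ x y z : L, ⁅⁅x, y⁆, z⁆ = 0) {X Y Z : L}
    (h : LinearIndependent K ![⁅X, Y⁆, ⁅X, Z⁆]) :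
    LinearIndependent K ![X, Y, ⁅X, Y⁆, Z, ⁅X, Z⁆] := by
  have h' : ∀ x y z : L, ⁅x, ⁅y, z⁆⁆ = 0 := fun x y z => by rw [← lie_skew, h2, neg_zero]
  rw [LinearIndependent.pair_iff] at h
  rw [Fintype.linearIndependent_iff]
  intro g hg
  simp only [Fin.sum_univ_five, Matrix.cons_val] at hg
  have e1 := congrArg (fun u => ⁅X, u⁆) hg
  simp only [lie_add, lie_smul, lie_self, h', smul_zero, zero_add, add_zero, lie_zero] at e1
  obtain ⟨g1, g3⟩ := h _ _ e1
  simp only [g1, g3, zero_smul, add_zero] at hg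
  have e2 := congrArg (fun u => ⁅u, Y⁆) hg
  simp only [add_lie, smul_lie, h2, smul_zero, add_zero, zero_lie] at e2
  obtain ⟨g0, -⟩ := h (g 0) 0 (by simpa using e2)
  simp only [g0, zero_smul, zero_add] at hg
  obtain ⟨g2, g4⟩ := h _ _ hg
  intro i
  fin_cases i <;> assumption

theorem linearIndependent_six (h2 : ∀ x y z : L, ⁅⁅x, y⁆, z⁆ = 0) {X Y Z : L}
    (h : LinearIndependent K ![⁅X, Y⁆, ⁅X, Z⁆, ⁅Y, Z⁆]) :
    LinearIndependent K ![X, Y, ⁅X, Y⁆, Z, ⁅X, Z⁆, ⁅Y, Z⁆] := by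
  have h' : ∀ x y z : L, ⁅x, ⁅y, z⁆⁆ = 0 := fun x y z => by rw [← lie_skew, h2, neg_zero]
  rw [linearIndependent_triple_iff] at h
  rw [Fintype.linearIndependent_iff]
  intro g hg
  simp only [Fin.sum_univ_six, Matrix.cons_val] at hg
  have e1 := congrArg (fun u => ⁅X, u⁆) hg
  simp only [lie_add, lie_smul, lie_self, h', smul_zero, zero_add, add_zero, lie_zero] at e1
  obtain ⟨g1, g3, -⟩ := h (g 1) (g 3) 0 (by simpa using e1)
  simp only [g1, g3, zero_smul, add_zero] at hg
  have e2 := congrArg (fun u => ⁅u, Y⁆) hg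
  simp only [add_lie, smul_lie, h2, smul_zero, add_zero, zero_lie] at e2
  obtain ⟨g0, -⟩ := h (g 0) 0 0 (by simpa using e2)
  simp only [g0, zero_smul, zero_add] at hg
  obtain ⟨g2, g4, g5⟩ := h _ _ _ hg
  intro i
  fin_cases i <;> assumption

open LieBracketOn

theorem exists_mem_componentOne [FiniteDimensional K L] {n : ℕ} (hn : finrank K L = n)
    (h2 : ∀ x y z : L, ⁅⁅x, y⁆, z⁆ = 0) (hc : IsCharacteristicSequence K L (seqTwoTwoOnes n))
    {X Y Z : L} (h : LinearIndependent K ![⁅X, Y⁆, ⁅X, Z⁆])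
    (hspan : ∀ u v : L, ∃ p q : K, ⁅u, v⁆ = p • ⁅X, Y⁆ + q • ⁅X, Z⁆) :
    ∃ μ ∈ componentOne K n, Nonempty (L ≃ₗ⁅K⁆ μ.Alg) := by
  obtain ⟨h5, b, hb, hbN⟩ := exists_basis_extending hn (linearIndependent_five h2 h)
    (LinearMap.ker (LieAlgebra.ad K L X)) (by
      rw [eq_top_iff]
      intro u _
      obtain ⟨p, q, hu⟩ := hspan X u
      refine Submodule.mem_sup.2 ⟨p • Y + q • Z, ?_, u - (p • Y + q • Z), ?_, by abel⟩
      · exact add_mem (Submodule.smul_mem _ _ (Submodule.subset_span ⟨1, rfl⟩))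
          (Submodule.smul_mem _ _ (Submodule.subset_span ⟨3, rfl⟩))
      · simp [hu])
  have h5 : 5 ≤ n := h5
  have hs : ∀ {i : ℕ} (hi : 1 ≤ i) (hi' : i ≤ n), b.equivFun.symm (stdX K n i) = b ⟨i - 1, by omega⟩ :=
    fun hi hi' => equivFun_symm_stdX b hi hi'
  have b1 : b.equivFun.symm (stdX K n 1) = X := by
    rw [hs le_rfl (by omega), hb _ (by simp)]; rfl
  have b2 : b.equivFun.symm (stdX K n 2) = Y := by
    rw [hs (by norm_num) (by omega), hb _ (by simp)]; rfl
  have b3 : b.equivFun.symm (stdX K n 3) = ⁅X, Y⁆ := by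
    rw [hs (by norm_num) (by omega), hb _ (by simp)]; rfl
  have b4 : b.equivFun.symm (stdX K n 4) = Z := by
    rw [hs (by norm_num) (by omega), hb _ (by simp)]; rfl
  have b5 : b.equivFun.symm (stdX K n 5) = ⁅X, Z⁆ := by
    rw [hs (by norm_num) (by omega), hb _ (by simp)]; rfl
  refine ⟨ofBasis b, mem_componentOne h5 ?_ ?_ ?_ ?_ ?_ ?_, ⟨ofBasisEquiv b⟩⟩
  · exact ofBasis_mem_familyF b h2 (h.ne_zero 0) hc
  · intro x y z
    simp [ofBasis_apply, h2]
  · rw [ofBasis_apply, b1, b2, ← b3, LinearEquiv.apply_symm_apply]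
  · rw [ofBasis_apply, b1, b4, ← b5, LinearEquiv.apply_symm_apply]
  · intro j hj hjn
    have : ⁅X, b ⟨j - 1, by omega⟩⁆ = 0 := hbN ⟨j - 1, by omega⟩ (by simp; omega)
    rw [ofBasis_apply, b1, hs (by omega) hjn, this, map_zero]
  · intro x y
    obtain ⟨p, q, hpq⟩ := hspan (b.equivFun.symm x) (b.equivFun.symm y)
    refine ⟨p, q, ?_⟩
    rw [ofBasis_apply, hpq, ← b3, ← b5, map_add, map_smul, map_smul, LinearEquiv.apply_symm_apply,
      LinearEquiv.apply_symm_apply]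

theorem exists_mem_componentTwo [FiniteDimensional K L] {n : ℕ} (hn : finrank K L = n)
    (h2 : ∀ x y z : L, ⁅⁅x, y⁆, z⁆ = 0) (hc : IsCharacteristicSequence K L (seqTwoTwoOnes n))
    {X Y Z : L} (h : LinearIndependent K ![⁅X, Y⁆, ⁅X, Z⁆, ⁅Y, Z⁆])
    (hcen : ∀ u, ∃ p q r : K, ∀ v : L, ⁅u - (p • X + q • Y + r • Z), v⁆ = 0) :
    ∃ μ ∈ componentTwo K n, Nonempty (L ≃ₗ⁅K⁆ μ.Alg) := by
  have hspan : ∀ u v : L, ∃ p q r : K, ⁅u, v⁆ = p • ⁅X, Y⁆ + q • ⁅X, Z⁆ + r • ⁅Y, Z⁆ := by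
    intro u v
    obtain ⟨p, q, r, hu⟩ := hcen u
    obtain ⟨p', q', r', hv⟩ := hcen v
    -- Modulo the centre u and v are combinations of X, Y, Z; the coefficients are the 2 × 2 minors.
    refine ⟨p * q' - q * p', p * r' - r * p', q * r' - r * q', ?_⟩
    have e1 : ⁅u, v⁆ = ⁅p • X + q • Y + r • Z, v⁆ := by rw [← sub_eq_zero, ← sub_lie, hu]
    have e2 : ⁅v, p • X + q • Y + r • Z⁆ = ⁅p' • X + q' • Y + r' • Z, p • X + q • Y + r • Z⁆ := by
      rw [← sub_eq_zero, ← sub_lie, hv]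
    rw [e1, ← lie_skew, e2]
    simp only [add_lie, lie_add, smul_lie, lie_smul, lie_self, ← lie_skew Y X, ← lie_skew Z X,
      ← lie_skew Z Y]
    module
  obtain ⟨h6, b', hb, hbN⟩ := exists_basis_extending hn (linearIndependent_six h2 h)
    (LinearMap.ker (LieAlgebra.ad K L : L →ₗ[K] Module.End K L)) (by
      rw [eq_top_iff]
      intro u _
      obtain ⟨p, q, r, hu⟩ := hcen u
      refine Submodule.mem_sup.2 ⟨p • X + q • Y + r • Z, ?_, u - (p • X + q • Y + r • Z), ?_,
        by abel⟩
      · exact add_mem (add_mem (Submodule.smul_mem _ _ (Submodule.subset_span ⟨0, rfl⟩))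
          (Submodule.smul_mem _ _ (Submodule.subset_span ⟨1, rfl⟩)))
          (Submodule.smul_mem _ _ (Submodule.subset_span ⟨3, rfl⟩))
      · exact LinearMap.ext hu)
  have h6 : 6 ≤ n := h6
  -- The extended basis has [Y,Z] in sixth position, while the second family wants it as Xₙ; for n =
  -- 6 the swap is trivial.
  set σ := Equiv.swap (⟨5, by omega⟩ : Fin n) ⟨n - 1, by omega⟩ with hσ
  let b := b'.reindex σ
  have hbσ : ∀ i, b i = b' (σ i) := fun i => by simp [b, hσ]
  have hlt : ∀ i : Fin n, (i : ℕ) < 5 → b i = b' i := by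
    intro i hi
    rw [hbσ, hσ, Equiv.swap_apply_of_ne_of_ne]
    · exact fun h => by simp [h] at hi
    · exact fun h => by simp [h] at hi; omega
  have hs : ∀ {i : ℕ} (hi : 1 ≤ i) (hi' : i ≤ n), b.equivFun.symm (stdX K n i) = b ⟨i - 1, by omega⟩ :=
    fun hi hi' => equivFun_symm_stdX b hi hi'
  have b1 : b.equivFun.symm (stdX K n 1) = X := by
    rw [hs le_rfl (by omega), hlt _ (by simp), hb _ (by simp)]; rfl
  have b2 : b.equivFun.symm (stdX K n 2) = Y := by
    rw [hs (by norm_num) (by omega), hlt _ (by simp), hb _ (by simp)]; rfl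
  have b3 : b.equivFun.symm (stdX K n 3) = ⁅X, Y⁆ := by
    rw [hs (by norm_num) (by omega), hlt _ (by simp), hb _ (by simp)]; rfl
  have b4 : b.equivFun.symm (stdX K n 4) = Z := by
    rw [hs (by norm_num) (by omega), hlt _ (by simp), hb _ (by simp)]; rfl
  have b5 : b.equivFun.symm (stdX K n 5) = ⁅X, Z⁆ := by
    rw [hs (by norm_num) (by omega), hlt _ (by simp), hb _ (by simp)]; rfl
  have b6 : b.equivFun.symm (stdX K n n) = ⁅Y, Z⁆ := by
    rw [hs (by omega) (by omega), hbσ, hσ, Equiv.swap_apply_right, hb _ (by simp)]; rfl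
  refine ⟨ofBasis b, mem_componentTwo h6 ?_ ?_ ?_ ?_ ?_ ?_, ⟨ofBasisEquiv b⟩⟩
  · exact ofBasis_mem_familyF b h2 (h.ne_zero 0) hc
  · rw [ofBasis_apply, b1, b2, ← b3, LinearEquiv.apply_symm_apply]
  · rw [ofBasis_apply, b1, b4, ← b5, LinearEquiv.apply_symm_apply]
  · rw [ofBasis_apply, b2, b4, ← b6, LinearEquiv.apply_symm_apply]
  · intro i hi hin i1 i2 i4 z
    rw [ofBasis_apply]
    suffices hz : ∀ v : L, ⁅b.equivFun.symm (stdX K n i), v⁆ = 0 by rw [hz, map_zero]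
    intro v
    by_cases i3 : i = 3
    · rw [i3, b3, h2]
    by_cases i5 : i = 5
    · rw [i5, b5, h2]
    by_cases i6 : i = n
    · rw [i6, b6, h2]
    have hmem : b ⟨i - 1, by omega⟩ ∈
        LinearMap.ker (LieAlgebra.ad K L : L →ₗ[K] Module.End K L) := by
      rw [hbσ]
      apply hbN
      change 6 ≤ (σ _ : ℕ)
      -- Position 6 now holds the former last vector, which is central because here n > 6.
      by_cases h' : i = 6
      · subst h'
        rw [hσ, show (⟨6 - 1, by omega⟩ : Fin n) = ⟨5, by omega⟩ from rfl, Equiv.swap_apply_left]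
        simp; omega
      · rw [hσ, Equiv.swap_apply_of_ne_of_ne] <;> simp [Fin.ext_iff] <;> omega
    rw [hs hi hin]
    exact LinearMap.congr_fun hmem v
  · intro x y
    obtain ⟨p, q, r, hpq⟩ := hspan (b.equivFun.symm x) (b.equivFun.symm y)
    refine ⟨p, q, r, ?_⟩
    rw [ofBasis_apply, hpq, ← b3, ← b5, ← b6]
    simp only [map_add, map_smul, LinearEquiv.apply_symm_apply]

end Lie

theorem proposition7 {K : Type*} [Field K] [CharZero K] (n : ℕ)
    {L : Type*} [LieRing L] [LieAlgebra K L] [FiniteDimensional K L] [LieRing.IsNilpotent L]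
    (hn : Module.finrank K L = n)
    (hb : lieBreadth K L = 2)
    (hc : IsCharacteristicSequence K L (seqTwoTwoOnes n)) :
    ∃ μ ∈ componentOne K n ∪ componentTwo K n, Nonempty (L ≃ₗ⁅K⁆ μ.Alg) := by
  have h2 : ∀ x y z : L, ⁅⁅x, y⁆, z⁆ = 0 := lie_lie_eq_zero_of_isCharacteristicSequence hb hc
  obtain ⟨X, -, hX⟩ := hc.1
  obtain ⟨Y, Z, hYZ⟩ := hX.exists_linearIndependent_pair
  rcases derived_or_center_of_lieBreadth_eq_two hb hYZ with hspan | ⟨hli, hcen⟩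
  · obtain ⟨μ, hμ, e⟩ := exists_mem_componentOne hn h2 hc hYZ hspan
    exact ⟨μ, Or.inl hμ, e⟩
  · obtain ⟨μ, hμ, e⟩ := exists_mem_componentTwo hn h2 hc hli hcen
    exact ⟨μ, Or.inr hμ, e⟩
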